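/- Work in the category $\mathbf{Hilb}$ of finite-dimensional complex Hilbert spaces and linear maps, where $\dagger$ is the adjoint, the tensor unit is $\mathbb{C}$, and inner products are antilinear in the first variable. For a Hilbert space $A$ let $A^*$ be the dual Hilbert space, with $A^{**}=A$ and $(A\otimes B)^*=B^*\otimes A^*$ (order reversing), let $\varepsilon_A:\mathbb{C}\to A^*\otimes A$, $1\mapsto\sum_i e_i^*\otimes e_i$, and for $f:A\to B$ let $f_*=(f^\dagger)^*:A^*\to B^*$, $\varphi\mapsto\varphi\circ f^\dagger$. Definitions. A monoid $(A,m,u)$ consists of linear maps $m:A\otimes A\to A$ and $u:\mathbb{C}\to A$ satisfying associativity and the two unit laws. An involution monoid $(A,m,u;s)$ is a monoid $(A,m,u)$ with a linear map $s:A\to A^*$ that is a morphism of monoids to $(A^*,m_*,u_*)$ and satisfies $s_*\circ s=\mathrm{id}_A$. Its underlying $*$-algebra is the unital complex algebra $(A,m,u)$ with the antilinear, order-reversing involution $t$ determined by $s(a)=\langle t(a),-\rangle$. A monoid $(A,m,u)$ is $\dagger$-Frobenius if it forms a Frobenius structure with the comonoid $(A,m^\dagger,u^\dagger)$, that is, $(m\otimes\mathrm{id})\circ(\mathrm{id}\otimes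 m^\dagger)=m^\dagger\circ m=(\mathrm{id}\otimes m)\circ(m^\dagger\otimes\mathrm{id})$. It then has the left involution $s_L=((u^\dagger\circ m)\otimes\mathrm{id}_{A^*})\circ(\mathrm{id}_A\otimes\varepsilon_{A^*})$ and the right involution $s_R=(\mathrm{id}_{A^*}\otimes(u^\dagger\circ m))\circ(\varepsilon_A\otimes\mathrm{id}_A)$, both maps $A\to A^*$; it is unitary if $s_L$ (equivalently $s_R$) is unitary, and special if $m\circ m^\dagger=\mathrm{id}_A$. A $\dagger$-Frobenius left- (or right-) involution monoid is an involution monoid $(A,m,u;s)$ such that $(A,m,u)$ is $\dagger$-Frobenius and $s=s_L$ (or $s=s_R$). A special unitary $\dagger$-Frobenius involution monoid is a $\dagger$-Frobenius left- or right-involution monoid whose monoid is unitary and special (in which case $s_L=s_R$). Given an involution monoid with underlying $*$-algebra $(A,m,u,t)$ and an inner product $g$ on the vector space $A$, replacing the inner product of $A$ by $g$ and keeping the $*$-algebra gives the involution monoid $(A,m,u;s_g)$ on the Hilbert space $(A,g)$, where $s_g(a)=g(t(a),-)$. Theorem. For every involution monoid $(A,m,u;s)$ in $\mathbf{Hilb}$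 the following are equivalent: (1) there is a norm on $A$ that makes its underlying $*$-algebra a C*-algebra; (2) there is an inner product $g$ on the vector space $A$ for which $(A,m,u;s_g)$ is a special unitary $\dagger$-Frobenius involution monoid; (3) there is an inner product $g$ on the vector space $A$ for which $(A,m,u;s_g)$ is a $\dagger$-Frobenius right-involution monoid. Furthermore, if these properties hold, then the norm in (1) and the inner product in (2) are unique. -/

import Mathlib

open scoped TensorProduct

noncomputable section

namespace HilbFrob

/-! ### The category of finite-dimensional complex Hilbert spaces

Objects are finite-dimensional complex inner product spaces, morphisms are linear maps, the dagger
is `LinearMap.adjoint`, the tensor product is the tensor product of Hilbert spaces and the unit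
object is `ℂ`. The dual of `H` is `Module.Dual ℂ H`, with the inner product transported along the
Riesz isomorphism; `H⋆⋆` is identified with `H` by evaluation, and `(H ⊗ K)⋆` with `K⋆ ⊗ H⋆`
(order reversing). -/

section Hilb

variable {H K : Type*}
  [NormedAddCommGroup H] [InnerProductSpace ℂ H] [FiniteDimensional ℂ H]
  [NormedAddCommGroup K] [InnerProductSpace ℂ K] [FiniteDimensional ℂ K]

/-- The antilinear isomorphism `x ↦ ⟪x, ·⟫` from a Hilbert space to its dual. -/
def riesz : H ≃ₗ⋆[ℂ] Module.Dual ℂ H :=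
  haveI := FiniteDimensional.complete ℂ H
  (InnerProductSpace.toDual ℂ H).toLinearEquiv.trans LinearMap.toContinuousLinearMap.symm

@[simp]
theorem riesz_apply (x y : H) : riesz x y = inner ℂ x y := rfl

@[simp]
theorem inner_riesz_symm (f : Module.Dual ℂ H) (y : H) : inner ℂ (riesz.symm f) y = f y := by
  rw [← riesz_apply, LinearEquiv.apply_symm_apply]

/-- The inner product of the dual Hilbert space. -/
@[reducible]
def dualCore (H : Type*) [NormedAddCommGroup H] [InnerProductSpace ℂ H] [FiniteDimensional ℂ H] :
    InnerProductSpace.Core ℂ (Module.Dual ℂ H) where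
  inner f g := inner ℂ (riesz.symm g) (riesz.symm f)
  conj_inner_symm f g := inner_conj_symm _ _
  re_inner_nonneg f := inner_self_nonneg
  add_left f g h := by rw [map_add, inner_add_right]
  smul_left f g r := by rw [map_smulₛₗ, inner_smul_right]
  definite f hf := by simpa using inner_self_eq_zero.1 hf

instance instNormedAddCommGroupDual : NormedAddCommGroup (Module.Dual ℂ H) :=
  (dualCore H).toNormedAddCommGroup

instance instInnerProductSpaceDual : InnerProductSpace ℂ (Module.Dual ℂ H) :=
  InnerProductSpace.ofCore (dualCore H).toCore

theorem inner_dual (f g : Module.Dual ℂ H) :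
    inner ℂ f g = inner ℂ (riesz.symm g) (riesz.symm f) := rfl

/-- The conjugation functor `f ↦ f_* = (f†)^*` on morphisms. -/
def conjMap (f : H →ₗ[ℂ] K) : Module.Dual ℂ H →ₗ[ℂ] Module.Dual ℂ K :=
  (LinearMap.adjoint f).dualMap

/-- The duality morphism `ε_H : ℂ → H⋆ ⊗ H`, `1 ↦ ∑ eᵢ⋆ ⊗ eᵢ`. -/
def cup (H : Type*) [NormedAddCommGroup H] [InnerProductSpace ℂ H] [FiniteDimensional ℂ H] :
    ℂ →ₗ[ℂ] Module.Dual ℂ H ⊗[ℂ] H :=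
  (TensorProduct.comm ℂ H (Module.Dual ℂ H)).toLinearMap ∘ₗ coevaluation ℂ H

/-- The duality morphism `ε_{H⋆} : ℂ → H⋆⋆ ⊗ H⋆ = H ⊗ H⋆`, `1 ↦ ∑ eᵢ ⊗ eᵢ⋆`. -/
def cupDual (H : Type*) [NormedAddCommGroup H] [InnerProductSpace ℂ H] [FiniteDimensional ℂ H] :
    ℂ →ₗ[ℂ] H ⊗[ℂ] Module.Dual ℂ H :=
  coevaluation ℂ H

/-- A morphism is unitary if its dagger is its two-sided inverse. -/
def IsUnitaryMap (f : H →ₗ[ℂ] K) : Prop :=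
  LinearMap.adjoint f ∘ₗ f = LinearMap.id ∧ f ∘ₗ LinearMap.adjoint f = LinearMap.id

/-! ### Monoids, comonoids, Frobenius structures -/

/-- `(H, m, u)` is a monoid. -/
structure IsMonoid (m : H ⊗[ℂ] H →ₗ[ℂ] H) (u : ℂ →ₗ[ℂ] H) : Prop where
  assoc : m ∘ₗ m.rTensor H = m ∘ₗ m.lTensor H ∘ₗ (TensorProduct.assoc ℂ H H H).toLinearMap
  unit_left : m ∘ₗ u.rTensor H = (TensorProduct.lid ℂ H).toLinearMap
  unit_right : m ∘ₗ u.lTensor H = (TensorProduct.rid ℂ H).toLinearMap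

/-- `(H, n, v)` is a comonoid. -/
structure IsComonoid (n : H →ₗ[ℂ] H ⊗[ℂ] H) (v : H →ₗ[ℂ] ℂ) : Prop where
  coassoc : (TensorProduct.assoc ℂ H H H).toLinearMap ∘ₗ n.rTensor H ∘ₗ n = n.lTensor H ∘ₗ n
  counit_left : v.rTensor H ∘ₗ n = (TensorProduct.lid ℂ H).symm.toLinearMap
  counit_right : v.lTensor H ∘ₗ n = (TensorProduct.rid ℂ H).symm.toLinearMap

/-- The monoid `(H, m, u)` and the comonoid `(H, n, v)` form a Frobenius structure. -/
structure IsFrobenius (m : H ⊗[ℂ] H →ₗ[ℂ] H) (u : ℂ →ₗ[ℂ] H)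
    (n : H →ₗ[ℂ] H ⊗[ℂ] H) (v : H →ₗ[ℂ] ℂ) : Prop where
  isMonoid : IsMonoid m u
  isComonoid : IsComonoid n v
  frobenius_left :
    m.rTensor H ∘ₗ (TensorProduct.assoc ℂ H H H).symm.toLinearMap ∘ₗ n.lTensor H = n ∘ₗ m
  frobenius_right :
    m.lTensor H ∘ₗ (TensorProduct.assoc ℂ H H H).toLinearMap ∘ₗ n.rTensor H = n ∘ₗ m

/-- `(H, m, u)` is a dagger-Frobenius monoid: it forms a Frobenius structure with its adjoint. -/
def IsDaggerFrobenius (m : H ⊗[ℂ] H →ₗ[ℂ] H) (u : ℂ →ₗ[ℂ] H) : Prop :=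
  IsFrobenius m u (LinearMap.adjoint m) (LinearMap.adjoint u)

/-- The monoid `(H, m, u)` is special: the comultiplication `m†` is an isometry. -/
def IsSpecial (m : H ⊗[ℂ] H →ₗ[ℂ] H) : Prop :=
  m ∘ₗ LinearMap.adjoint m = LinearMap.id

/-- The left involution `s_L = ((u† ∘ m) ⊗ id) ∘ (id ⊗ ε_{H⋆}) : H → H⋆`. -/
def leftInvolution (m : H ⊗[ℂ] H →ₗ[ℂ] H) (u : ℂ →ₗ[ℂ] H) : H →ₗ[ℂ] Module.Dual ℂ H :=
  (TensorProduct.lid ℂ (Module.Dual ℂ H)).toLinearMap ∘ₗ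
    (LinearMap.adjoint u ∘ₗ m).rTensor (Module.Dual ℂ H) ∘ₗ
    (TensorProduct.assoc ℂ H H (Module.Dual ℂ H)).symm.toLinearMap ∘ₗ
    (cupDual H).lTensor H ∘ₗ
    (TensorProduct.rid ℂ H).symm.toLinearMap

/-- The right involution `s_R = (id ⊗ (u† ∘ m)) ∘ (ε_H ⊗ id) : H → H⋆`. -/
def rightInvolution (m : H ⊗[ℂ] H →ₗ[ℂ] H) (u : ℂ →ₗ[ℂ] H) : H →ₗ[ℂ] Module.Dual ℂ H :=
  (TensorProduct.rid ℂ (Module.Dual ℂ H)).toLinearMap ∘ₗ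
    (LinearMap.adjoint u ∘ₗ m).lTensor (Module.Dual ℂ H) ∘ₗ
    (TensorProduct.assoc ℂ (Module.Dual ℂ H) H H).toLinearMap ∘ₗ
    (cup H).rTensor H ∘ₗ
    (TensorProduct.lid ℂ H).symm.toLinearMap

/-! ### Involution monoids -/

/-- The multiplication `m_* : H⋆ ⊗ H⋆ = (H ⊗ H)⋆ → H⋆`. -/
def conjMul (m : H ⊗[ℂ] H →ₗ[ℂ] H) :
    Module.Dual ℂ H ⊗[ℂ] Module.Dual ℂ H →ₗ[ℂ] Module.Dual ℂ H :=
  conjMap m ∘ₗ TensorProduct.dualDistrib ℂ H H ∘ₗ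
    (TensorProduct.comm ℂ (Module.Dual ℂ H) (Module.Dual ℂ H)).toLinearMap

/-- The unit `u_* : ℂ = ℂ⋆ → H⋆`. -/
def conjUnit (u : ℂ →ₗ[ℂ] H) : ℂ →ₗ[ℂ] Module.Dual ℂ H :=
  conjMap u ∘ₗ LinearMap.toSpanSingleton ℂ (Module.Dual ℂ ℂ) LinearMap.id

/-- The conjugate `s_* : H⋆ → H⋆⋆ = H` of a linear map `s : H → H⋆`. -/
def conjInv (s : H →ₗ[ℂ] Module.Dual ℂ H) : Module.Dual ℂ H →ₗ[ℂ] H :=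
  (Module.evalEquiv ℂ H).symm.toLinearMap ∘ₗ conjMap s

/-- An involution monoid `(H, m, u; s)` on the Hilbert space `H`: a monoid `(H, m, u)` with a
linear involution `s : H → H⋆` that is a morphism of monoids to `(H⋆, m_*, u_*)` and satisfies
`s_* ∘ s = id`. -/
structure InvolutionMonoid (H : Type*)
    [NormedAddCommGroup H] [InnerProductSpace ℂ H] [FiniteDimensional ℂ H] where
  mul : H ⊗[ℂ] H →ₗ[ℂ] H
  unit : ℂ →ₗ[ℂ] H
  inv : H →ₗ[ℂ] Module.Dual ℂ H
  isMonoid : IsMonoid mul unit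
  inv_mul : inv ∘ₗ mul = conjMul mul ∘ₗ TensorProduct.map inv inv
  inv_unit : inv ∘ₗ unit = conjUnit unit
  inv_inv : conjInv inv ∘ₗ inv = LinearMap.id

theorem conjMap_riesz (f : H →ₗ[ℂ] K) (x : H) : conjMap f (riesz x) = riesz (f x) := by
  ext y
  simp [conjMap, LinearMap.adjoint_inner_right]

theorem conjMul_riesz (m : H ⊗[ℂ] H →ₗ[ℂ] H) (x y : H) :
    conjMul m (riesz x ⊗ₜ riesz y) = riesz (m (y ⊗ₜ x)) := by
  have h : TensorProduct.dualDistrib ℂ H H (riesz y ⊗ₜ riesz x) = riesz (y ⊗ₜ[ℂ] x) := by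
    ext a b
    simp
  simp [conjMul, h, conjMap_riesz]

theorem conjUnit_one (u : ℂ →ₗ[ℂ] H) : conjUnit u 1 = riesz (u 1) := by
  have h : (LinearMap.id : Module.Dual ℂ ℂ) = riesz (1 : ℂ) := by
    ext
    simp
  rw [← conjMap_riesz, ← h]
  simp [conjUnit]

theorem conjInv_apply (s : H →ₗ[ℂ] Module.Dual ℂ H) (f : Module.Dual ℂ H) :
    conjInv s f = riesz.symm (s (riesz.symm f)) := by
  obtain ⟨x, rfl⟩ := riesz.surjective f
  simp only [conjInv, LinearMap.comp_apply, conjMap_riesz, LinearEquiv.coe_coe,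
    LinearEquiv.symm_apply_apply]
  rw [LinearEquiv.symm_apply_eq]
  ext g
  rw [riesz_apply, inner_dual, inner_riesz_symm]
  rfl

/-! ### The underlying complex `*`-algebra of an involution monoid -/

namespace InvolutionMonoid

/-- The antilinear involution `t` of the underlying `*`-algebra, `t(a) = (s a)_*`, that is
`⟪t a, b⟫ = s a b`. -/
def starMap (M : InvolutionMonoid H) (a : H) : H := riesz.symm (M.inv a)

theorem riesz_starMap (M : InvolutionMonoid H) (a : H) : riesz (M.starMap a) = M.inv a :=
  riesz.apply_symm_apply _

theorem starMap_starMap (M : InvolutionMonoid H) (a : H) : M.starMap (M.starMap a) = a := by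
  have h := LinearMap.congr_fun M.inv_inv a
  rwa [LinearMap.comp_apply, conjInv_apply] at h

theorem starMap_mul (M : InvolutionMonoid H) (a b : H) :
    M.starMap (M.mul (a ⊗ₜ b)) = M.mul (M.starMap b ⊗ₜ M.starMap a) := by
  have h := LinearMap.congr_fun M.inv_mul (a ⊗ₜ b)
  apply riesz.injective
  rw [riesz_starMap, ← conjMul_riesz, riesz_starMap, riesz_starMap]
  simpa using h

theorem starMap_unit (M : InvolutionMonoid H) : M.starMap (M.unit 1) = M.unit 1 := by
  have h := LinearMap.congr_fun M.inv_unit 1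
  apply riesz.injective
  rw [riesz_starMap, ← conjUnit_one]
  simpa using h

theorem starMap_add (M : InvolutionMonoid H) (a b : H) :
    M.starMap (a + b) = M.starMap a + M.starMap b := by
  simp [starMap]

theorem starMap_smul (M : InvolutionMonoid H) (c : ℂ) (a : H) :
    M.starMap (c • a) = star c • M.starMap a := by
  rw [starMap, map_smul, map_smulₛₗ]
  rfl

theorem zero_mul' (M : InvolutionMonoid H) (a : H) : M.mul (0 ⊗ₜ a) = 0 := by simp

theorem mul_zero' (M : InvolutionMonoid H) (a : H) : M.mul (a ⊗ₜ 0) = 0 := by simp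

theorem mul_add' (M : InvolutionMonoid H) (a b c : H) :
    M.mul (a ⊗ₜ (b + c)) = M.mul (a ⊗ₜ b) + M.mul (a ⊗ₜ c) := by
  rw [TensorProduct.tmul_add, map_add]

theorem add_mul' (M : InvolutionMonoid H) (a b c : H) :
    M.mul ((a + b) ⊗ₜ c) = M.mul (a ⊗ₜ c) + M.mul (b ⊗ₜ c) := by
  rw [TensorProduct.add_tmul, map_add]

theorem mul_assoc' (M : InvolutionMonoid H) (a b c : H) :
    M.mul (M.mul (a ⊗ₜ b) ⊗ₜ c) = M.mul (a ⊗ₜ M.mul (b ⊗ₜ c)) := by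
  simpa using LinearMap.congr_fun M.isMonoid.assoc ((a ⊗ₜ b) ⊗ₜ c)

theorem one_mul' (M : InvolutionMonoid H) (a : H) : M.mul (M.unit 1 ⊗ₜ a) = a := by
  simpa using LinearMap.congr_fun M.isMonoid.unit_left (1 ⊗ₜ a)

theorem mul_one' (M : InvolutionMonoid H) (a : H) : M.mul (a ⊗ₜ M.unit 1) = a := by
  simpa using LinearMap.congr_fun M.isMonoid.unit_right (a ⊗ₜ 1)

theorem smul_mul' (M : InvolutionMonoid H) (r : ℂ) (a b : H) :
    M.mul ((r • a) ⊗ₜ b) = r • M.mul (a ⊗ₜ b) := by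
  rw [← TensorProduct.smul_tmul', map_smul]

theorem mul_smul' (M : InvolutionMonoid H) (r : ℂ) (a b : H) :
    M.mul (a ⊗ₜ (r • b)) = r • M.mul (a ⊗ₜ b) := by
  rw [TensorProduct.tmul_smul, map_smul]

/-- The underlying `*`-algebra of the involution monoid `M`; its carrier is `H`. -/
def Alg (_M : InvolutionMonoid H) : Type _ := H

variable (M : InvolutionMonoid H)

instance : AddCommGroup M.Alg := inferInstanceAs (AddCommGroup H)

instance : Module ℂ M.Alg := inferInstanceAs (Module ℂ H)

instance : Ring M.Alg where
  __ := (inferInstance : AddCommGroup M.Alg)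
  mul a b := M.mul ((a : H) ⊗ₜ[ℂ] (b : H))
  one := M.unit 1
  zero_mul := M.zero_mul'
  mul_zero := M.mul_zero'
  left_distrib := M.mul_add'
  right_distrib := M.add_mul'
  mul_assoc := M.mul_assoc'
  one_mul := M.one_mul'
  mul_one := M.mul_one'
  neg_add_cancel := neg_add_cancel
  zsmul := fun n a => n • a
  zsmul_zero' := SubNegMonoid.zsmul_zero'
  zsmul_succ' := SubNegMonoid.zsmul_succ'
  zsmul_neg' := SubNegMonoid.zsmul_neg'

instance : Algebra ℂ M.Alg :=
  Algebra.ofModule M.smul_mul' M.mul_smul'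

instance : StarRing M.Alg where
  star a := M.starMap a
  star_involutive := M.starMap_starMap
  star_mul := M.starMap_mul
  star_add := M.starMap_add

instance : StarModule ℂ M.Alg where
  star_smul := M.starMap_smul

end InvolutionMonoid

/-- The involution monoid determined by a monoid and an antilinear, involutive, order-reversing
and unit-preserving map `t`; its linear involution is `a ↦ ⟪t a, ·⟫`. -/
def InvolutionMonoid.ofStar (m : H ⊗[ℂ] H →ₗ[ℂ] H) (u : ℂ →ₗ[ℂ] H) (h : IsMonoid m u) (t : H → H)
    (t_add : ∀ a b, t (a + b) = t a + t b) (t_smul : ∀ (c : ℂ) a, t (c • a) = star c • t a)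
    (t_t : ∀ a, t (t a) = a) (t_mul : ∀ a b, t (m (a ⊗ₜ b)) = m (t b ⊗ₜ t a))
    (t_unit : t (u 1) = u 1) : InvolutionMonoid H where
  mul := m
  unit := u
  inv :=
    { toFun := fun a => riesz (t a)
      map_add' := fun a b => by rw [t_add, map_add]
      map_smul' := fun c a => by rw [t_smul, map_smulₛₗ]; simp }
  isMonoid := h
  inv_mul := by
    refine TensorProduct.ext' fun a b => ?_
    simp [conjMul_riesz, t_mul]
  inv_unit := by
    refine LinearMap.ext_ring ?_
    rw [conjUnit_one]
    simp [t_unit]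
  inv_inv := by
    ext a
    simp [conjInv_apply, t_t]

end Hilb

/-! ### Changing the inner product -/

section Reinner

variable {H : Type*} [NormedAddCommGroup H] [InnerProductSpace ℂ H]

/-- The complex vector space `H`, equipped with the inner product `g` instead of its own. -/
def Reinner (_g : InnerProductSpace.Core ℂ H) : Type _ := H

variable (g : InnerProductSpace.Core ℂ H)

instance : NormedAddCommGroup (Reinner g) := g.toNormedAddCommGroup

instance : InnerProductSpace ℂ (Reinner g) := InnerProductSpace.ofCore g.toCore

/-- The identity map. -/
def toReinner : H ≃ₗ[ℂ] Reinner g where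
  toFun x := x
  invFun x := x
  map_add' _ _ := rfl
  map_smul' _ _ := rfl
  left_inv _ := rfl
  right_inv _ := rfl

theorem inner_toReinner (x y : H) : inner ℂ (toReinner g x) (toReinner g y) = g.inner x y := rfl

variable [FiniteDimensional ℂ H]

instance : FiniteDimensional ℂ (Reinner g) := (toReinner g).finiteDimensional

/-- The involution monoid on `H`, equipped with the inner product `g`, that has the same underlying
`*`-algebra as `M`. Its linear involution is `a ↦ g(t a, ·)`, where `t` is the antilinear involution
of that `*`-algebra. -/
def InvolutionMonoid.withInner (M : InvolutionMonoid H) (g : InnerProductSpace.Core ℂ H) :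
    InvolutionMonoid (Reinner g) :=
  InvolutionMonoid.ofStar
    (H := Reinner g)
    ((toReinner g).toLinearMap ∘ₗ M.mul ∘ₗ
      TensorProduct.map (toReinner g).symm.toLinearMap (toReinner g).symm.toLinearMap)
    ((toReinner g).toLinearMap ∘ₗ M.unit)
    { assoc := by
        refine TensorProduct.ext_threefold fun a b c => ?_
        simpa using LinearMap.congr_fun M.isMonoid.assoc
          (((toReinner g).symm a ⊗ₜ[ℂ] (toReinner g).symm b) ⊗ₜ[ℂ] (toReinner g).symm c)
      unit_left := by
        refine TensorProduct.ext' fun c a => ?_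
        have := LinearMap.congr_fun M.isMonoid.unit_left (c ⊗ₜ[ℂ] (toReinner g).symm a)
        simp at this
        simp [this]
      unit_right := by
        refine TensorProduct.ext' fun a c => ?_
        have := LinearMap.congr_fun M.isMonoid.unit_right ((toReinner g).symm a ⊗ₜ[ℂ] c)
        simp at this
        simp [this] }
    (fun a => toReinner g (M.starMap ((toReinner g).symm a)))
    (fun a b => by simp [M.starMap_add])
    (fun c a => by simp [M.starMap_smul])
    (fun a => by simp [M.starMap_starMap])
    (fun a b => by simp [M.starMap_mul])
    (by simp [M.starMap_unit])

end Reinner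

/-! ### The three properties -/

section Properties

variable {H : Type*} [NormedAddCommGroup H] [InnerProductSpace ℂ H] [FiniteDimensional ℂ H]

/-- A submultiplicative norm on a complex `*`-algebra makes it a (unital) C⋆-algebra: it satisfies
the C⋆-identity and it is complete. -/
structure IsCStarNorm {A : Type*} [Ring A] [Algebra ℂ A] [StarRing A] (N : AlgebraNorm ℂ A) :
    Prop where
  star_mul_self : ∀ a : A, N (star a * a) = N a * N a
  complete : @CompleteSpace A
    (N.toRingNorm.toNormedRing.toMetricSpace.toPseudoMetricSpace.toUniformSpace)

/-- The resulting C⋆-algebra, with the given algebraic structure. -/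
abbrev IsCStarNorm.toCStarAlgebra {A : Type*} [Ring A] [Algebra ℂ A] [StarRing A] [StarModule ℂ A]
    {N : AlgebraNorm ℂ A} (h : IsCStarNorm N) : CStarAlgebra A where
  __ := N.toRingNorm.toNormedRing
  __ := (inferInstance : StarRing A)
  __ := (inferInstance : Algebra ℂ A)
  __ := (inferInstance : StarModule ℂ A)
  __ := h.complete
  norm_smul_le c a := (N.smul' c a).le
  norm_mul_self_le a := (h.star_mul_self a).ge

/-- `(H, m, u; s)` is a dagger-Frobenius left-involution monoid. -/
def InvolutionMonoid.IsDaggerFrobeniusLeft (M : InvolutionMonoid H) : Prop :=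
  IsDaggerFrobenius M.mul M.unit ∧ M.inv = leftInvolution M.mul M.unit

/-- `(H, m, u; s)` is a dagger-Frobenius right-involution monoid. -/
def InvolutionMonoid.IsDaggerFrobeniusRight (M : InvolutionMonoid H) : Prop :=
  IsDaggerFrobenius M.mul M.unit ∧ M.inv = rightInvolution M.mul M.unit

/-- `(H, m, u; s)` is a special unitary dagger-Frobenius involution monoid: a dagger-Frobenius left-
or right-involution monoid whose underlying monoid is unitary (the left involution is a unitary
map) and special. -/
structure InvolutionMonoid.IsSpecialUnitaryDaggerFrobenius (M : InvolutionMonoid H) : Prop where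
  daggerFrobenius : M.IsDaggerFrobeniusLeft ∨ M.IsDaggerFrobeniusRight
  unitary : IsUnitaryMap (leftInvolution M.mul M.unit)
  special : IsSpecial M.mul

end Properties

end HilbFrob

end

open scoped TensorProduct ComplexOrder

noncomputable section

namespace HilbFrob

/-! ### The regular trace on a finite-dimensional C⋆-algebra -/

/-! The canonical inner product is `g(a, b) = Tr(L_{t(a) b})`, where `L` is left multiplication;
conditions (1) and (2) both lead to it. From a C⋆-norm: the eigenvalues of `L_{a⋆a}` lie in the
spectrum of `a⋆a`, hence are nonnegative, and if they sum to zero then `a⋆a` is nilpotent and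
self-adjoint, so `a = 0`. Thus `g` is an inner product. Traciality gives `s = s_L = s_R`, from which
the Frobenius laws and unitarity follow. Speciality rests on `inner_mul_adjoint_mul_unit`: when `s =
s_L = s_R`, the vector `m m†(1)` represents the regular trace. For `g` that vector is `1`, and a
Frobenius law spreads `m m†(1) = 1` to all of `A`. Conversely, speciality forces `⟪1, a⟫ = Tr(L_a)`,
so the inner product in (2) is unique. From `s = s_R`: right multiplication by `t(a)` is the adjoint
of right multiplication by `a`, so the right regular representation is a faithful
`*`-antirepresentation, whose operator norm is a C⋆-norm. A C⋆-norm is unique because `N(a)²` is the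
spectral radius of `a⋆a`. -/

/-- The trace of the left regular representation of an algebra. -/
def regTrace (A : Type*) [Ring A] [Algebra ℂ A] : A →ₗ[ℂ] ℂ :=
  LinearMap.trace ℂ A ∘ₗ (Algebra.lmul ℂ A).toLinearMap

theorem regTrace_mul_comm {A : Type*} [Ring A] [Algebra ℂ A] (a b : A) :
    regTrace A (a * b) = regTrace A (b * a) := by
  simp only [regTrace, LinearMap.comp_apply, AlgHom.toLinearMap_apply, map_mul]
  exact LinearMap.trace_mul_comm ℂ _ _

theorem nonneg_of_mem_spectrum_star_mul_self {A : Type*} [CStarAlgebra A] {a : A}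
    {z : ℂ} (hz : z ∈ spectrum ℂ (star a * a)) :
    0 ≤ z := by
  have h := (IsSelfAdjoint.star_mul_self a).mem_spectrum_eq_re hz
  rw [h] at hz ⊢
  rw [Complex.zero_le_real]
  exact spectrum_star_mul_self_nonneg (b := a) _
    ((spectrum.algebraMap_mem_iff (S := ℂ) (R := ℝ)).1 hz)

section CStar

variable {A : Type*} [CStarAlgebra A] [FiniteDimensional ℂ A]

theorem regTrace_eq_sum_roots_charpoly (a : A) :
    regTrace A a = (Algebra.lmul ℂ A a).charpoly.roots.sum :=
  Module.End.trace_eq_sum_roots_charpoly_of_splits (IsAlgClosed.splits _)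

/-- Algebra homomorphisms only shrink spectra; this carries C⋆-algebraic facts about the spectrum
over to the regular trace. -/
theorem mem_spectrum_of_mem_roots_charpoly_lmul {a : A} {z : ℂ}
    (hz : z ∈ (Algebra.lmul ℂ A a).charpoly.roots) : z ∈ spectrum ℂ a := by
  refine AlgHom.spectrum_apply_subset (Algebra.lmul ℂ A) a ?_
  rw [← Module.End.hasEigenvalue_iff_mem_spectrum, Module.End.hasEigenvalue_iff_isRoot_charpoly]
  exact Polynomial.isRoot_of_mem_roots hz

theorem star_regTrace_of_isSelfAdjoint {a : A} (ha : IsSelfAdjoint a) :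
    star (regTrace A a) = regTrace A a := by
  rw [regTrace_eq_sum_roots_charpoly, ← starRingEnd_apply, map_multiset_sum,
    Multiset.map_congr rfl (g := id), Multiset.map_id]
  intro z hz
  rw [ha.mem_spectrum_eq_re (mem_spectrum_of_mem_roots_charpoly_lmul hz)]
  simp

theorem regTrace_star (a : A) : regTrace A (star a) = star (regTrace A a) := by
  have h1 := star_regTrace_of_isSelfAdjoint (realPart a).2
  have h2 := star_regTrace_of_isSelfAdjoint (imaginaryPart a).2
  conv_lhs => rw [← realPart_add_I_smul_imaginaryPart a]
  conv_rhs => rw [← realPart_add_I_smul_imaginaryPart a]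
  rw [star_add, star_smul, (realPart a).2.star_eq, (imaginaryPart a).2.star_eq]
  simp only [map_add, map_smul, star_add, star_smul, h1, h2]

theorem regTrace_star_mul_self_nonneg (a : A) : 0 ≤ regTrace A (star a * a) := by
  rw [regTrace_eq_sum_roots_charpoly]
  exact Multiset.sum_nonneg fun z hz => nonneg_of_mem_spectrum_star_mul_self
    (mem_spectrum_of_mem_roots_charpoly_lmul hz)

/-- Nonnegative eigenvalues with zero sum all vanish, so left multiplication by `star a * a` is
nilpotent, and a nilpotent self-adjoint element is zero. -/
theorem eq_zero_of_regTrace_star_mul_self {a : A} (h : regTrace A (star a * a) = 0) :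
    a = 0 := by
  rw [regTrace_eq_sum_roots_charpoly] at h
  have h0 : ∀ z ∈ (Algebra.lmul ℂ A (star a * a)).charpoly.roots, z = 0 :=
    Multiset.all_zero_of_le_zero_le_of_sum_eq_zero (fun z hz =>
      nonneg_of_mem_spectrum_star_mul_self (mem_spectrum_of_mem_roots_charpoly_lmul hz)) h
  have hnil : IsNilpotent (Algebra.lmul ℂ A (star a * a)) := by
    rw [LinearMap.isNilpotent_iff_charpoly]
    have hs := IsAlgClosed.splits (Algebra.lmul ℂ A (star a * a)).charpoly
    have hp := hs.eq_prod_roots_of_monic (LinearMap.charpoly_monic _)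
    rw [Multiset.eq_replicate_of_mem h0] at hp
    simp only [Multiset.map_replicate, map_zero, sub_zero, Multiset.prod_replicate,
      ← hs.natDegree_eq_card_roots, LinearMap.charpoly_natDegree] at hp
    exact hp
  rw [IsNilpotent.map_iff (Algebra.lmul_injective)] at hnil
  obtain ⟨n, hn⟩ := hnil
  -- For self-adjoint `x`, `‖x ^ 2 ^ n‖ = ‖x‖ ^ 2 ^ n`; the left side vanishes since `n < 2 ^ n`.
  have hpow := (IsSelfAdjoint.star_mul_self a).nnnorm_pow_two_pow n
  rw [pow_eq_zero_of_le Nat.lt_two_pow_self.le hn, nnnorm_zero, eq_comm] at hpow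
  exact CStarRing.star_mul_self_eq_zero_iff a |>.1 (nnnorm_eq_zero.1 (eq_zero_of_pow_eq_zero hpow))

end CStar

/-! ### C⋆-norms on a complex `*`-algebra -/

section Norms

variable {A : Type*} [Ring A] [Algebra ℂ A] [StarRing A]

/-- The norm of a self-adjoint element is its spectral radius, which depends on the algebra alone.
-/
theorem IsCStarNorm.mul_self_eq_spectralRadius [StarModule ℂ A] {N : AlgebraNorm ℂ A}
    (h : IsCStarNorm N) (a : A) :
    ENNReal.ofReal (N a * N a) = spectralRadius ℂ (star a * a) := by
  let := h.toCStarAlgebra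
  rw [← h.star_mul_self a]
  refine Eq.trans ?_ (IsSelfAdjoint.star_mul_self a).spectralRadius_eq_nnnorm.symm
  exact ofReal_norm (star a * a)

theorem IsCStarNorm.unique [StarModule ℂ A] {N N' : AlgebraNorm ℂ A} (h : IsCStarNorm N)
    (h' : IsCStarNorm N') :
    N = N' := by
  ext a
  have e := (h.mul_self_eq_spectralRadius a).trans (h'.mul_self_eq_spectralRadius a).symm
  rw [ENNReal.ofReal_eq_ofReal_iff (mul_self_nonneg _) (mul_self_nonneg _)] at e
  exact (mul_self_inj (apply_nonneg N a) (apply_nonneg N' a)).1 e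

/-- A finite-dimensional complex `*`-algebra with a faithful `*`-antirepresentation on a Hilbert
space carries a C⋆-norm. -/
theorem exists_isCStarNorm_of_antirepresentation [FiniteDimensional ℂ A] {K : Type*}
    [NormedAddCommGroup K] [InnerProductSpace ℂ K] [CompleteSpace K] (π : A →ₗ[ℂ] K →L[ℂ] K)
    (hinj : Function.Injective π) (hmul : ∀ a b, π (a * b) = π b * π a)
    (hstar : ∀ a, π (star a) = star (π a)) : ∃ N : AlgebraNorm ℂ A, IsCStarNorm N := by
  let N : AlgebraNorm ℂ A :=
    { toFun := fun a => ‖π a‖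
      map_zero' := by simp
      add_le' := fun a b => by rw [map_add]; exact norm_add_le _ _
      neg' := fun a => by rw [map_neg, norm_neg]
      mul_le' := fun a b => by rw [hmul, mul_comm ‖π a‖]; exact norm_mul_le _ _
      smul' := fun c a => by rw [map_smul, norm_smul]
      eq_zero_of_map_eq_zero' := fun a ha =>
        hinj ((norm_eq_zero.1 ha).trans (map_zero π).symm) }
  refine ⟨N, ?_, ?_⟩
  · intro a
    change ‖π (star a * a)‖ = ‖π a‖ * ‖π a‖
    -- Order reversal produces `π a * star (π a)`, hence this form of the C⋆-identity.
    rw [hmul, hstar, CStarRing.norm_self_mul_star]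
  · let := N.toRingNorm.toNormedRing
    let : NormedSpace ℂ A := { norm_smul_le := fun c a => (N.smul' c a).le }
    exact FiniteDimensional.complete ℂ A

end Norms

/-! ### Involutions of a dagger-Frobenius monoid, evaluated -/

section Hilb

variable {H : Type*} [NormedAddCommGroup H] [InnerProductSpace ℂ H] [FiniteDimensional ℂ H]

theorem adjoint_unit_apply (u : ℂ →ₗ[ℂ] H) (x : H) :
    LinearMap.adjoint u x = inner ℂ (u 1) x := by
  rw [← LinearMap.adjoint_inner_right]
  simp

/-- Expanding `x` in the basis that defines `coevaluation` collapses the diagram to a bilinear form.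
-/
theorem leftInvolution_apply (m : H ⊗[ℂ] H →ₗ[ℂ] H) (u : ℂ →ₗ[ℂ] H) (a x : H) :
    leftInvolution m u a x = inner ℂ (u 1) (m (a ⊗ₜ x)) := by
  conv_rhs => rw [← (Module.Basis.ofVectorSpace ℂ H).sum_repr x]
  simp [leftInvolution, cupDual, coevaluation_apply_one, TensorProduct.tmul_sum,
    adjoint_unit_apply, mul_comm]

theorem rightInvolution_apply (m : H ⊗[ℂ] H →ₗ[ℂ] H) (u : ℂ →ₗ[ℂ] H) (a x : H) :
    rightInvolution m u a x = inner ℂ (u 1) (m (x ⊗ₜ a)) := by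
  conv_rhs => rw [← (Module.Basis.ofVectorSpace ℂ H).sum_repr x]
  simp [rightInvolution, cup, coevaluation_apply_one, TensorProduct.sum_tmul,
    ← TensorProduct.smul_tmul', adjoint_unit_apply, mul_comm]

/-- The adjoint of a monoid is a comonoid. -/
theorem IsMonoid.isComonoid_adjoint {m : H ⊗[ℂ] H →ₗ[ℂ] H} {u : ℂ →ₗ[ℂ] H} (h : IsMonoid m u) :
    IsComonoid (LinearMap.adjoint m) (LinearMap.adjoint u) where
  coassoc := by
    ext x
    rw [TensorProduct.ext_iff_inner_left_threefold']
    intro a b c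
    have e : m (m (a ⊗ₜ b) ⊗ₜ c) = m (a ⊗ₜ m (b ⊗ₜ c)) := by
      simpa using LinearMap.congr_fun h.assoc ((a ⊗ₜ b) ⊗ₜ c)
    simp only [LinearMap.comp_apply, LinearEquiv.coe_coe]
    -- The associator is an isometry, so it cancels from the inner product; moving the adjoints
    -- across leaves associativity of `m`.
    rw [← TensorProduct.assoc_tmul, TensorProduct.inner_assoc_assoc, TensorProduct.assoc_tmul,
      ← LinearMap.adjoint_rTensor, ← LinearMap.adjoint_lTensor, LinearMap.adjoint_inner_right,
      LinearMap.rTensor_tmul, LinearMap.adjoint_inner_right,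
      LinearMap.adjoint_inner_right, LinearMap.lTensor_tmul, LinearMap.adjoint_inner_right, e]
  counit_left := by
    have e := congrArg (fun f => LinearMap.adjoint f) h.unit_left
    have ha : LinearMap.adjoint (TensorProduct.lid ℂ H).toLinearMap =
        (TensorProduct.lid ℂ H).symm.toLinearMap :=
      (TensorProduct.lidIsometry ℂ H).adjoint_toLinearMap_eq_symm
    simpa only [LinearMap.adjoint_comp, LinearMap.adjoint_rTensor, ha] using e
  counit_right := by
    have e := congrArg (fun f => LinearMap.adjoint f) h.unit_right
    have ha : LinearMap.adjoint (TensorProduct.rid ℂ H).toLinearMap =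
        (TensorProduct.rid ℂ H).symm.toLinearMap :=
      (TensorProduct.ridIsometry ℂ H).adjoint_toLinearMap_eq_symm
    simpa only [LinearMap.adjoint_comp, LinearMap.adjoint_lTensor, ha] using e

/-! ### Consequences of `s = s_L` and `s = s_R`, and the regular trace -/

namespace InvolutionMonoid

variable (M : InvolutionMonoid H)

theorem inv_apply (a x : H) : M.inv a x = inner ℂ (M.starMap a) x := by
  rw [← riesz_starMap, riesz_apply]

theorem inv_eq_leftInvolution_iff : M.inv = leftInvolution M.mul M.unit ↔
    ∀ a x, inner ℂ (M.starMap a) x = inner ℂ (M.unit 1) (M.mul (a ⊗ₜ x)) := by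
  simp_rw [LinearMap.ext_iff, inv_apply, leftInvolution_apply]

theorem inv_eq_rightInvolution_iff : M.inv = rightInvolution M.mul M.unit ↔
    ∀ a x, inner ℂ (M.starMap a) x = inner ℂ (M.unit 1) (M.mul (x ⊗ₜ a)) := by
  simp_rw [LinearMap.ext_iff, inv_apply, rightInvolution_apply]

variable {M}

/-- If `s = s_R`, right multiplication by `t a` is the adjoint of right multiplication by `a`. -/
theorem inner_mul_right_of_inv_eq (h : M.inv = rightInvolution M.mul M.unit) (a b c : H) :
    inner ℂ a (M.mul (b ⊗ₜ c)) = inner ℂ (M.mul (a ⊗ₜ M.starMap c)) b := by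
  rw [inv_eq_rightInvolution_iff] at h
  -- Both sides equal `⟪1, b (c (t a))⟫`.
  rw [← M.starMap_starMap a, h, M.mul_assoc', ← M.starMap_mul, h]

/-- If `s = s_L`, left multiplication by `t a` is the adjoint of left multiplication by `a`. -/
theorem inner_mul_left_of_inv_eq (h : M.inv = leftInvolution M.mul M.unit) (a b c : H) :
    inner ℂ a (M.mul (b ⊗ₜ c)) = inner ℂ (M.mul (M.starMap b ⊗ₜ a)) c := by
  rw [inv_eq_leftInvolution_iff] at h
  rw [← M.starMap_starMap a, h, ← M.mul_assoc', ← M.starMap_mul, h]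

/-- Write `J a` for the vector representing `s_L a`. Then `⟪t (J a), b⟫ = ⟪1, b (J a)⟫ = ⟪J b, J a⟫
= ⟪a, b⟫`, using `s = s_R`, the definition of `J`, and that `s_L` is an isometry. -/
theorem starMap_riesz_symm_leftInvolution (hu : IsUnitaryMap (leftInvolution M.mul M.unit))
    (h : M.inv = rightInvolution M.mul M.unit) (a : H) :
    M.starMap (riesz.symm (leftInvolution M.mul M.unit a)) = a := by
  rw [inv_eq_rightInvolution_iff] at h
  refine ext_inner_right ℂ fun b => ?_
  rw [h, ← leftInvolution_apply, ← inner_riesz_symm, ← inner_dual,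
    ← LinearMap.adjoint_inner_right, ← LinearMap.comp_apply, hu.1, LinearMap.id_apply]

/-- Unitarity makes the left and right involutions agree. If `s = s_L`, then `⟪1, x a⟫ = ⟪t x, a⟫ =
⟪t a, x⟫` because `s` is an isometry; if `s = s_R`, the preceding lemma applies. -/
theorem IsSpecialUnitaryDaggerFrobenius.inv_eq (h : M.IsSpecialUnitaryDaggerFrobenius) :
    M.inv = leftInvolution M.mul M.unit ∧ M.inv = rightInvolution M.mul M.unit := by
  rcases h.daggerFrobenius with ⟨-, hL⟩ | ⟨-, hR⟩
  · refine ⟨hL, ?_⟩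
    have hu := h.unitary.1
    rw [← hL] at hu
    rw [inv_eq_leftInvolution_iff] at hL
    rw [inv_eq_rightInvolution_iff]
    intro a x
    rw [← hL]
    conv_rhs => rw [← LinearMap.id_apply (R := ℂ) a, ← hu, LinearMap.comp_apply,
      LinearMap.adjoint_inner_right, inner_dual]
    simp only [← riesz_starMap, LinearEquiv.symm_apply_apply, M.starMap_starMap]
  · refine ⟨LinearMap.ext fun a => riesz.symm.injective ?_, hR⟩
    rw [← M.starMap_starMap (riesz.symm (leftInvolution M.mul M.unit a)),
      starMap_riesz_symm_leftInvolution h.unitary hR, starMap]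

theorem IsSpecialUnitaryDaggerFrobenius.isDaggerFrobeniusRight
    (h : M.IsSpecialUnitaryDaggerFrobenius) : M.IsDaggerFrobeniusRight :=
  ⟨h.daggerFrobenius.elim And.left And.left, h.inv_eq.2⟩

/-- The comultiplication of the unit in an orthonormal basis. -/
theorem adjoint_mul_unit (h : M.inv = rightInvolution M.mul M.unit)
    {ι : Type*} [Fintype ι] (e : OrthonormalBasis ι ℂ H)
    (hs : ∀ a b, inner ℂ (M.starMap a) b = inner ℂ (M.starMap b) a) :
    LinearMap.adjoint M.mul (M.unit 1) = ∑ i, e i ⊗ₜ[ℂ] M.starMap (e i) := by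
  rw [TensorProduct.ext_iff_inner_left]
  intro a b
  rw [LinearMap.adjoint_inner_right, inner_sum]
  simp_rw [TensorProduct.inner_tmul]
  -- This makes the sum `∑ ⟪a, e i⟫ ⟪e i, t b⟫ = ⟪a, t b⟫`, which equals `⟪a b, 1⟫`.
  have hb : ∀ i, inner ℂ b (M.starMap (e i)) = inner ℂ (e i) (M.starMap b) := fun i => by
    rw [← inner_conj_symm, hs, inner_conj_symm]
  simp_rw [hb]
  rw [e.sum_inner_mul_inner, ← M.one_mul' (M.starMap b), inner_mul_right_of_inv_eq h, M.starMap_starMap]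

theorem regTrace_eq_sum_inner {ι : Type*} [Fintype ι] (e : OrthonormalBasis ι ℂ H) (a : H) :
    regTrace M.Alg a = ∑ i, inner ℂ (e i) (M.mul (a ⊗ₜ e i)) :=
  LinearMap.trace_eq_sum_inner (TensorProduct.curry M.mul a) e

theorem inner_starMap_comm (hL : M.inv = leftInvolution M.mul M.unit)
    (hR : M.inv = rightInvolution M.mul M.unit) (a b : H) :
    inner ℂ (M.starMap a) b = inner ℂ (M.starMap b) a := by
  rw [inv_eq_leftInvolution_iff] at hL
  rw [inv_eq_rightInvolution_iff] at hR
  rw [hL, hR]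

/-- As `m†(1) = ∑ eᵢ ⊗ t eᵢ`, moving `t eᵢ` across the inner product turns `⟪eᵢ (t eᵢ), a⟫` into
`⟪eᵢ, a eᵢ⟫`, a diagonal entry of left multiplication by `a`. -/
theorem inner_mul_adjoint_mul_unit (hL : M.inv = leftInvolution M.mul M.unit)
    (hR : M.inv = rightInvolution M.mul M.unit) (a : H) :
    inner ℂ (M.mul (LinearMap.adjoint M.mul (M.unit 1))) a = regTrace M.Alg a := by
  let e := stdOrthonormalBasis ℂ H
  rw [adjoint_mul_unit hR e (inner_starMap_comm hL hR), regTrace_eq_sum_inner e, map_sum, sum_inner]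
  simp_rw [← inner_mul_right_of_inv_eq hR]

/-- The inner product of a special unitary dagger-Frobenius involution monoid comes from the
regular trace. -/
theorem IsSpecialUnitaryDaggerFrobenius.inner_eq (h : M.IsSpecialUnitaryDaggerFrobenius)
    (a b : H) : inner ℂ a b = regTrace M.Alg (M.mul (M.starMap a ⊗ₜ b)) := by
  obtain ⟨hL, hR⟩ := h.inv_eq
  -- Speciality replaces `m m†(1)` by `1`, and `s = s_L` turns `⟪1, t(a) b⟫` into `⟪a, b⟫`.
  rw [← inner_mul_adjoint_mul_unit hL hR, ← LinearMap.comp_apply, h.special, LinearMap.id_apply,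
    ← (inv_eq_leftInvolution_iff M).1 hL, M.starMap_starMap]

/-- Each Frobenius law is associativity read through an adjoint: tested against `a ⊗ b`, left
multiplication by `c` moves across as left multiplication by `t c`, and `(t(c) a) b = t(c) (a b)`;
likewise on the right. -/
theorem isDaggerFrobenius_of_inv_eq (hL : M.inv = leftInvolution M.mul M.unit)
    (hR : M.inv = rightInvolution M.mul M.unit) : IsDaggerFrobenius M.mul M.unit where
  isMonoid := M.isMonoid
  isComonoid := M.isMonoid.isComonoid_adjoint
  frobenius_left := by
    refine TensorProduct.ext' fun c d => ?_
    have hc : ∀ z : H ⊗[ℂ] H, M.mul.rTensor H ((TensorProduct.assoc ℂ H H H).symm (c ⊗ₜ z)) =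
        (TensorProduct.curry M.mul c).rTensor H z := fun z =>
      z.induction_on (by simp) (by simp) fun x y hx hy => by
        simp only [TensorProduct.tmul_add, map_add, hx, hy]
    have had : LinearMap.adjoint (TensorProduct.curry M.mul c) =
        TensorProduct.curry M.mul (M.starMap c) := by
      rw [eq_comm, LinearMap.eq_adjoint_iff]
      exact fun x y => (inner_mul_left_of_inv_eq hL x c y).symm
    simp only [LinearMap.comp_apply, LinearMap.lTensor_tmul, LinearEquiv.coe_coe, hc]
    rw [TensorProduct.ext_iff_inner_left]
    intro a b
    rw [← LinearMap.adjoint_inner_left, LinearMap.adjoint_rTensor, had, LinearMap.rTensor_tmul,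
      LinearMap.adjoint_inner_right, LinearMap.adjoint_inner_right, TensorProduct.curry_apply,
      M.mul_assoc', inner_mul_left_of_inv_eq hL]
  frobenius_right := by
    refine TensorProduct.ext' fun d c => ?_
    have hc : ∀ z : H ⊗[ℂ] H, M.mul.lTensor H (TensorProduct.assoc ℂ H H H (z ⊗ₜ c)) =
        ((TensorProduct.curry M.mul).flip c).lTensor H z := fun z =>
      z.induction_on (by simp) (by simp) fun x y hx hy => by
        simp only [TensorProduct.add_tmul, map_add, hx, hy]
    have had : LinearMap.adjoint ((TensorProduct.curry M.mul).flip c) =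
        (TensorProduct.curry M.mul).flip (M.starMap c) := by
      rw [eq_comm, LinearMap.eq_adjoint_iff]
      exact fun x y => (inner_mul_right_of_inv_eq hR x y c).symm
    simp only [LinearMap.comp_apply, LinearMap.rTensor_tmul, LinearEquiv.coe_coe, hc]
    rw [TensorProduct.ext_iff_inner_left]
    intro a b
    rw [← LinearMap.adjoint_inner_left, LinearMap.adjoint_lTensor, had, LinearMap.lTensor_tmul,
      LinearMap.adjoint_inner_right, LinearMap.adjoint_inner_right, LinearMap.flip_apply,
      TensorProduct.curry_apply, ← M.mul_assoc', inner_mul_right_of_inv_eq hR]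

/-- Symmetry of `⟪t a, b⟫` makes `s` an isometry, and `t` being an involution makes it surjective.
-/
theorem isUnitaryMap_of_inv_eq (hL : M.inv = leftInvolution M.mul M.unit)
    (hR : M.inv = rightInvolution M.mul M.unit) : IsUnitaryMap (leftInvolution M.mul M.unit) := by
  rw [← hL]
  have h1 : LinearMap.adjoint M.inv ∘ₗ M.inv = LinearMap.id := by
    ext a
    refine ext_inner_left ℂ fun b => ?_
    rw [LinearMap.comp_apply, LinearMap.adjoint_inner_right, inner_dual, ← riesz_starMap,
      ← riesz_starMap, LinearEquiv.symm_apply_apply, LinearEquiv.symm_apply_apply,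
      inner_starMap_comm hL hR, M.starMap_starMap, LinearMap.id_apply]
  refine ⟨h1, LinearMap.ext fun f => ?_⟩
  obtain ⟨a, rfl⟩ : ∃ a, M.inv a = f :=
    ⟨M.starMap (riesz.symm f), by
      rw [← riesz_starMap, M.starMap_starMap, LinearEquiv.apply_symm_apply]⟩
  exact congrArg M.inv (LinearMap.congr_fun h1 a)

/-- If the inner product comes from the regular trace, then the involution monoid is special,
unitary and dagger-Frobenius. -/
theorem isSpecialUnitaryDaggerFrobenius_of_inner_eq
    (h : ∀ a b : H, inner ℂ a b = regTrace M.Alg (M.mul (M.starMap a ⊗ₜ b))) :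
    M.IsSpecialUnitaryDaggerFrobenius := by
  have hL : M.inv = leftInvolution M.mul M.unit := by
    rw [inv_eq_leftInvolution_iff]
    intro a x
    rw [h, h, M.starMap_starMap, M.starMap_unit, M.one_mul']
  have hR : M.inv = rightInvolution M.mul M.unit := by
    rw [inv_eq_rightInvolution_iff]
    intro a x
    rw [h, h, M.starMap_starMap, M.starMap_unit, M.one_mul']
    exact regTrace_mul_comm (A := M.Alg) a x
  have hF := isDaggerFrobenius_of_inv_eq hL hR
  refine ⟨Or.inl ⟨hF, hL⟩, isUnitaryMap_of_inv_eq hL hR, ?_⟩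
  have h1 : M.mul (LinearMap.adjoint M.mul (M.unit 1)) = M.unit 1 :=
    ext_inner_right ℂ fun a => by
      rw [inner_mul_adjoint_mul_unit hL hR, h, M.starMap_unit, M.one_mul']
  let e := stdOrthonormalBasis ℂ H
  rw [adjoint_mul_unit hR e (inner_starMap_comm hL hR)] at h1
  ext x
  -- The Frobenius law at `x ⊗ 1` gives `m†(x) = ∑ x eᵢ ⊗ t eᵢ`, so `m m†(x) = x · m m†(1) = x`.
  have hx := LinearMap.congr_fun hF.frobenius_left (x ⊗ₜ M.unit 1)
  simp only [LinearMap.comp_apply, M.mul_one', LinearMap.lTensor_tmul,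
    adjoint_mul_unit hR e (inner_starMap_comm hL hR), TensorProduct.tmul_sum, map_sum,
    LinearEquiv.coe_coe, TensorProduct.assoc_symm_tmul, LinearMap.rTensor_tmul] at hx
  rw [LinearMap.comp_apply, ← hx, map_sum]
  simp_rw [M.mul_assoc']
  rw [← map_sum, ← TensorProduct.tmul_sum, ← map_sum, h1, M.mul_one', LinearMap.id_apply]

end InvolutionMonoid

end Hilb

/-! ### Changing the inner product of an involution monoid -/

namespace InvolutionMonoid

variable {H : Type*} [NormedAddCommGroup H] [InnerProductSpace ℂ H] [FiniteDimensional ℂ H]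
  (M : InvolutionMonoid H) (g : InnerProductSpace.Core ℂ H)

theorem withInner_mul (a b : H) :
    (M.withInner g).mul (toReinner g a ⊗ₜ toReinner g b) = toReinner g (M.mul (a ⊗ₜ b)) := rfl

theorem withInner_starMap (a : H) :
    (M.withInner g).starMap (toReinner g a) = toReinner g (M.starMap a) :=
  riesz.symm_apply_apply _

theorem regTrace_withInner (a : H) :
    regTrace (M.withInner g).Alg (toReinner g a) = regTrace M.Alg a :=
  LinearMap.trace_conj' (TensorProduct.curry M.mul a) (toReinner g)

/-- The right side mentions only the `*`-algebra and `g`, so it yields both existence and uniqueness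
of `g`. -/
theorem withInner_isSpecialUnitaryDaggerFrobenius_iff :
    (M.withInner g).IsSpecialUnitaryDaggerFrobenius ↔
      ∀ a b : H, g.inner a b = regTrace M.Alg (M.mul (M.starMap a ⊗ₜ b)) := by
  have key : ∀ a b : H, regTrace (M.withInner g).Alg ((M.withInner g).mul
      ((M.withInner g).starMap (toReinner g a) ⊗ₜ toReinner g b)) =
        regTrace M.Alg (M.mul (M.starMap a ⊗ₜ b)) := fun a b => by
    rw [withInner_starMap, withInner_mul, regTrace_withInner]
  constructor
  · intro h a b
    rw [← inner_toReinner, h.inner_eq, key]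
  · intro h
    refine isSpecialUnitaryDaggerFrobenius_of_inner_eq fun a b => ?_
    exact (h a b).trans (key a b).symm

theorem exists_isCStarNorm_of_withInner
    (h : (M.withInner g).inv = rightInvolution (M.withInner g).mul (M.withInner g).unit) :
    ∃ N : AlgebraNorm ℂ M.Alg, IsCStarNorm N := by
  have := FiniteDimensional.complete ℂ (Reinner g)
  have : FiniteDimensional ℂ M.Alg := inferInstanceAs (FiniteDimensional ℂ H)
  -- Right multiplication; it is injective because the unit recovers `a` from `1 · a`.
  let π : H →ₗ[ℂ] Reinner g →L[ℂ] Reinner g := LinearMap.toContinuousLinearMap.toLinearMap ∘ₗ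
    (TensorProduct.curry (M.withInner g).mul).flip ∘ₗ (toReinner g).toLinearMap
  refine exists_isCStarNorm_of_antirepresentation (A := M.Alg) π ?_ ?_ ?_
  · intro a b hab
    have := congrArg (fun f : Reinner g →L[ℂ] Reinner g => f (M.unit 1)) hab
    exact (M.one_mul' a).symm.trans (this.trans (M.one_mul' b))
  · intro a b
    ext x
    exact (M.mul_assoc' x a b).symm
  · intro a
    rw [ContinuousLinearMap.star_eq_adjoint, ContinuousLinearMap.eq_adjoint_iff]
    intro x y
    have hxy := inner_mul_right_of_inv_eq h x y (toReinner g (a : H))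
    rw [withInner_starMap M g (a : H)] at hxy
    exact hxy.symm

theorem exists_core_of_isCStarNorm {N : AlgebraNorm ℂ M.Alg} (h : IsCStarNorm N) :
    ∃ g : InnerProductSpace.Core ℂ H,
      ∀ a b : H, g.inner a b = regTrace M.Alg (M.mul (M.starMap a ⊗ₜ b)) := by
  let := h.toCStarAlgebra
  have : FiniteDimensional ℂ M.Alg := inferInstanceAs (FiniteDimensional ℂ H)
  refine ⟨{ inner := fun a b => regTrace M.Alg (M.mul (M.starMap a ⊗ₜ b))
            conj_inner_symm := fun a b => ?_
            re_inner_nonneg := fun a => ?_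
            add_left := fun a b c => ?_
            smul_left := fun a b r => ?_
            definite := fun a ha => ?_ }, fun _ _ => rfl⟩
  · refine (regTrace_star (A := M.Alg) _).symm.trans (congrArg (regTrace M.Alg) ?_)
    exact (M.starMap_mul _ _).trans (by rw [M.starMap_starMap])
  · exact (Complex.le_def.1 (regTrace_star_mul_self_nonneg (A := M.Alg) a)).1
  · rw [M.starMap_add, M.add_mul']
    exact map_add (regTrace M.Alg) _ _
  · rw [M.starMap_smul, M.smul_mul']
    exact map_smul (regTrace M.Alg) _ _
  · exact eq_zero_of_regTrace_star_mul_self (A := M.Alg) ha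

end InvolutionMonoid

end HilbFrob

end

/-! ### The equivalence and the uniqueness statements -/

theorem mainTheorem1 {H : Type*} [NormedAddCommGroup H] [InnerProductSpace ℂ H]
    [FiniteDimensional ℂ H] (M : HilbFrob.InvolutionMonoid H) :
    List.TFAE
      [∃ N : AlgebraNorm ℂ M.Alg, HilbFrob.IsCStarNorm N,
        ∃ g : InnerProductSpace.Core ℂ H, (M.withInner g).IsSpecialUnitaryDaggerFrobenius,
        ∃ g : InnerProductSpace.Core ℂ H, (M.withInner g).IsDaggerFrobeniusRight] ∧
    ((∃ N : AlgebraNorm ℂ M.Alg, HilbFrob.IsCStarNorm N) →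
      (∃! N : AlgebraNorm ℂ M.Alg, HilbFrob.IsCStarNorm N) ∧
      (∃! g : InnerProductSpace.Core ℂ H,
        (M.withInner g).IsSpecialUnitaryDaggerFrobenius)) := by
  constructor
  · tfae_have 1 → 2
    | ⟨N, hN⟩ => by
      obtain ⟨g, hg⟩ := M.exists_core_of_isCStarNorm hN
      exact ⟨g, (M.withInner_isSpecialUnitaryDaggerFrobenius_iff g).2 hg⟩
    tfae_have 2 → 3
    | ⟨g, hg⟩ => ⟨g, hg.isDaggerFrobeniusRight⟩
    tfae_have 3 → 1
    | ⟨g, hg⟩ => M.exists_isCStarNorm_of_withInner g hg.2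
    tfae_finish
  · rintro ⟨N, hN⟩
    refine ⟨⟨N, hN, fun N' hN' => hN'.unique hN⟩, ?_⟩
    obtain ⟨g, hg⟩ := M.exists_core_of_isCStarNorm hN
    refine ⟨g, (M.withInner_isSpecialUnitaryDaggerFrobenius_iff g).2 hg, fun g' hg' => ?_⟩
    have hg'' := (M.withInner_isSpecialUnitaryDaggerFrobenius_iff g').1 hg'
    have e : g'.inner = g.inner := funext fun a => funext fun b => (hg'' a b).trans (hg a b).symm
    -- An inner product core is its `inner` function together with proofs, so equal functions
    -- suffice.
    rcases g with ⟨⟨⟨_⟩⟩⟩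
    rcases g' with ⟨⟨⟨_⟩⟩⟩
    cases e
    rfl
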